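/- For a finite set $A$ of integers and an integer $h\ge 1$, let $$hA=\Big\{\sum_{a\in A}\lambda_a a \;:\; \lambda_a\in\mathbb{Z}_{\ge 0},\ \sum_{a\in A}\lambda_a=h\Big\}$$ be its $h$-fold sumset. Let $h,k,i$ be integers with $i\ge 2$ such that either $k\ge 6$ and $h\ge i+4$, or $k\ge 5$ and $h\ge i+5$. Then there is no set $A$ of $k$ integers with $$hk+2h+2\le |hA|=hk+2h+i\le hk+3h-4 .$$ -/

import Mathlib

open scoped BigOperators

/-- The `h`-fold sumset `hA` of a finite set `A` of integers: all sums `∑ a ∈ A, c a * a`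
with nonnegative integer coefficients `c` such that `∑ a ∈ A, c a = h`. -/
def hFoldSumset (h : ℕ) (A : Finset ℤ) : Finset ℤ :=
  (A.piAntidiag h).image (fun c : ℤ → ℕ => ∑ a ∈ A, (c a : ℤ) * a)

theorem mem_hFoldSumset (h : ℕ) (A : Finset ℤ) (n : ℤ) :
    n ∈ hFoldSumset h A ↔
      ∃ c : ℤ → ℕ, ∑ a ∈ A, c a = h ∧ ∑ a ∈ A, (c a : ℤ) * a = n := by
  classical
  simp only [hFoldSumset, Finset.mem_image, Finset.mem_piAntidiag]
  constructor
  · rintro ⟨c, ⟨hc, -⟩, hn⟩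
    exact ⟨c, hc, hn⟩
  · rintro ⟨c, hc, hn⟩
    refine ⟨fun a => if a ∈ A then c a else 0, ⟨?_, ?_⟩, ?_⟩
    · rw [← hc]
      exact Finset.sum_congr rfl fun a ha => by simp [ha]
    · intro a ha
      by_contra hA
      simp [hA] at ha
    · rw [← hn]
      exact Finset.sum_congr rfl fun a ha => by simp [ha]

open Finset Pointwise

/-! Normalise `A` to have minimum 0, maximum `l` and gcd 1. If `l ≤ k + 2`, then `hA` lies in `[0,
hl]` and has at most `hk + 2h + 1` elements, too few as `i ≥ 2`. If `l ≥ k + 3`, it has at least `hk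
+ 3h - 3` elements (one less if `k = 5`), too many. For the second bound let `B` be `A` modulo `l`.
Passing from `jA` to `(j+1)A` gains at least `|(j+1)B|` elements, and Olson's theorem makes `|jB|`
grow by at least `|B|/2 ≥ (k-1)/2` per step until it reaches `l`. -/

/-- Olson's bound: adding a generating set `B` containing `0` to `C` gains at least `B.card / 2`
elements unless it fills the group. -/
theorem olson_card_add {G : Type*} [AddCommGroup G] [Fintype G] [DecidableEq G] {B : Finset G}
    (h0 : 0 ∈ B) (hgen : ∀ H : AddSubgroup G, (B : Set G) ⊆ H → H = ⊤)
    {C : Finset G} (hC : C.Nonempty) (hCB : C + B ≠ univ) :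
    2 * C.card + B.card ≤ 2 * (C + B).card := by
  classical
  have hsub : ∀ X : Finset G, X ⊆ X + B := fun X => subset_add_left X h0
  let S : Finset (Finset G) := univ.filter fun X => X.Nonempty ∧ X + B ≠ univ
  obtain ⟨X₀, hX₀S, hX₀min⟩ := exists_min_image S (fun X => (X + B).card - X.card)
    ⟨C, by simp [S, hC, hCB]⟩
  -- Isoperimetric method: sets attaining the minimal growth `κ` are fragments, and a smallest
  -- fragment `X₁` is an atom.
  obtain ⟨κ, hκ⟩ : ∃ κ, κ = (X₀ + B).card - X₀.card := ⟨_, rfl⟩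
  have hmin : ∀ X : Finset G, X.Nonempty → X + B ≠ univ → X.card + κ ≤ (X + B).card := by
    intro X hX hXB
    have h1 := hX₀min X (by simp [S, hX, hXB])
    have h2 := card_le_card (hsub X)
    omega
  let F : Finset (Finset G) := S.filter fun X => (X + B).card = X.card + κ
  obtain ⟨X₁, hX₁F, hX₁min⟩ := exists_min_image F card
    ⟨X₀, by have := card_le_card (hsub X₀); simp only [F, mem_filter, hX₀S, true_and]; omega⟩
  have hF : ∀ X, X ∈ F ↔ (X.Nonempty ∧ X + B ≠ univ) ∧ (X + B).card = X.card + κ := by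
    intro X; simp [F, S]
  have key : ∀ X ∈ F, ∀ Y ∈ F, X.card = X₁.card → (X ∩ Y).Nonempty → X ⊆ Y := by
    intro X hX Y hY hXc hXY
    obtain ⟨⟨hXn, hXu⟩, hXk⟩ := (hF X).1 hX
    obtain ⟨⟨hYn, hYu⟩, hYk⟩ := (hF Y).1 hY
    have hcapsub : (X ∩ Y) + B ⊆ (X + B) ∩ (Y + B) :=
      subset_inter (add_subset_add_right inter_subset_left)
        (add_subset_add_right inter_subset_right)
    have hcapu : (X ∩ Y) + B ≠ univ := fun h => hXu <| by
      rw [eq_univ_iff_forall] at h ⊢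
      exact fun g => (mem_inter.1 (hcapsub (h g))).1
    have h1 := hmin _ hXY hcapu
    have h2 := card_le_card hcapsub
    have h3 := card_union_add_card_inter (X + B) (Y + B)
    have h4 := card_union_add_card_inter X Y
    have hXYpos := hXY.card_pos
    have hcupu : (X ∪ Y) + B ≠ univ := by
      intro h
      -- The dual of a fragment is a fragment, so it has at least `|X|` elements. If `X ∪ Y + B`
      -- were everything, `(X + B) ∩ (Y + B)` would then have at most `κ` elements, fewer than `X ∩
      -- Y + B`.
      have hZ : (-(Y + B)ᶜ) ∈ F := by
        have hZn : (-(Y + B)ᶜ).Nonempty := by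
          rw [neg_nonempty_iff, nonempty_iff_ne_empty, Ne, compl_eq_empty_iff]
          exact hYu
        have hdis : -(Y + B)ᶜ + B ⊆ (-Y)ᶜ := by
          intro g hg
          obtain ⟨z, hz, b, hb, rfl⟩ := mem_add.1 hg
          rw [mem_compl]
          intro hy
          rw [mem_neg'] at hy hz
          rw [mem_compl] at hz
          exact hz (mem_add.2 ⟨_, hy, b, hb, by abel⟩)
        have hZu : -(Y + B)ᶜ + B ≠ univ := by
          intro h
          rw [h] at hdis
          obtain ⟨y, hy⟩ := hYn
          have := hdis (mem_univ (-y))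
          simp [hy] at this
        have h5 := hmin _ hZn hZu
        have h6 := card_le_card hdis
        rw [card_compl, card_neg] at h6
        rw [card_neg, card_compl] at h5
        have h7 := card_le_univ (Y + B)
        refine (hF _).2 ⟨⟨hZn, hZu⟩, ?_⟩
        rw [card_neg, card_compl]
        omega
      have h5 := hX₁min _ hZ
      rw [card_neg, card_compl] at h5
      have h7 := card_le_univ (Y + B)
      rw [← union_add, h, card_univ] at h3
      omega
    have h5 := hmin _ (hXn.mono subset_union_left) hcupu
    rw [union_add] at h5
    have h6 := hX₁min (X ∩ Y) ((hF _).2 ⟨⟨hXY, hcapu⟩, by omega⟩)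
    exact inter_eq_left.1 (eq_of_subset_of_card_le inter_subset_left (by omega))
  obtain ⟨⟨⟨x₁, hx₁⟩, hX₁u⟩, hX₁k⟩ := (hF X₁).1 hX₁F
  have htrans : ∀ g : G, ({g} + X₁) ∈ F := by
    intro g
    refine (hF _).2 ⟨⟨(singleton_nonempty g).add ⟨x₁, hx₁⟩, fun h => hX₁u ?_⟩, ?_⟩
    · rw [add_assoc] at h
      apply eq_univ_of_card
      rw [← card_singleton_add g (X₁ + B), h, card_univ]
    · rw [add_assoc, card_singleton_add, card_singleton_add, hX₁k]
  -- Translates of an atom that meet coincide, so an atom through 0 is a subgroup.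
  let X := {-x₁} + X₁
  have hXF : X ∈ F := htrans _
  have hXc : X.card = X₁.card := card_singleton_add _ _
  have hX0 : 0 ∈ X := mem_add.2 ⟨-x₁, by simp, x₁, hx₁, by simp⟩
  have hXsub : ∀ x ∈ X, ∀ y ∈ X, y - x ∈ X := by
    intro x hx y hy
    have hT : {-x} + X ∈ F := by
      rw [← add_assoc, singleton_add_singleton]; exact htrans _
    have h0T : (0 : G) ∈ {-x} + X := mem_add.2 ⟨-x, by simp, x, hx, by simp⟩
    exact key _ hT _ hXF (by rw [card_singleton_add, hXc]) ⟨0, mem_inter.2 ⟨h0T, hX0⟩⟩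
      (mem_add.2 ⟨-x, by simp, y, hy, by abel⟩)
  let H : AddSubgroup G :=
    { carrier := X
      zero_mem' := hX0
      neg_mem' := fun {x} hx => by simpa using hXsub x hx 0 hX0
      add_mem' := fun {x y} hx hy => by
        have h1 : -y ∈ X := by simpa using hXsub y hy 0 hX0
        simpa using hXsub (-y) h1 x hx }
  obtain ⟨⟨-, hXu⟩, hXk⟩ := (hF X).1 hXF
  obtain ⟨b, hb, hbX⟩ : ∃ b ∈ B, b ∉ X := by
    by_contra! hcon
    have hH := hgen H (fun b hb => hcon b hb)
    apply hXu
    rw [eq_univ_iff_forall]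
    intro g
    have : g ∈ H := hH ▸ AddSubgroup.mem_top g
    exact hsub X this
  -- Two cosets in `X + B` give `|X| ≤ κ`, so `|B| ≤ |X| + κ ≤ 2κ`.
  have h1 : X ∪ ({b} + X) ⊆ X + B := by
    apply union_subset (hsub X)
    rw [add_comm]
    exact add_subset_add_left (singleton_subset_iff.2 hb)
  have h2 : Disjoint X ({b} + X) := by
    rw [disjoint_left]
    intro x hx hx'
    obtain ⟨y, hy, rfl⟩ := by simpa [mem_add] using hx'
    exact hbX (by simpa using hXsub _ hy _ hx)
  have h3 := card_le_card h1
  rw [card_union_of_disjoint h2, card_singleton_add b X] at h3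
  have h4 : B.card ≤ (X + B).card := card_le_card (subset_add_right B hX0)
  have h5 := hmin C hC hCB
  omega

theorem add_eq_univ_of_card_lt {G : Type*} [AddCommGroup G] [Fintype G] [DecidableEq G]
    {B C : Finset G} (h : Fintype.card G < B.card + C.card) : B + C = univ := by
  rw [eq_univ_iff_forall]
  intro g
  have h1 : (B ∩ ({g} + -C)).Nonempty := by
    rw [← card_pos]
    have h2 := card_union_add_card_inter B ({g} + -C)
    have h3 := card_le_univ (B ∪ ({g} + -C))
    rw [card_singleton_add, card_neg] at h2
    omega
  obtain ⟨b, hb⟩ := h1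
  rw [mem_inter] at hb
  obtain ⟨c, hc, rfl⟩ := by simpa [mem_add] using hb.2
  exact mem_add.2 ⟨_, hb.1, -c, by simpa using hc, by abel⟩

/-! ### Sumsets of integers and their residues modulo the diameter -/

theorem hFoldSumset_eq_nsmul (h : ℕ) (A : Finset ℤ) : hFoldSumset h A = h • A := by
  classical
  induction h with
  | zero =>
    ext n
    rw [mem_hFoldSumset, zero_nsmul, mem_zero]
    constructor
    · rintro ⟨c, hc, rfl⟩
      rw [sum_eq_zero_iff] at hc
      exact sum_eq_zero fun a ha => by simp [hc a ha]
    · rintro rfl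
      exact ⟨0, by simp, by simp⟩
  | succ h ih =>
    ext n
    rw [succ_nsmul, mem_add, mem_hFoldSumset, ← ih]
    constructor
    · rintro ⟨c, hc, rfl⟩
      obtain ⟨a, ha, hca⟩ : ∃ a ∈ A, c a ≠ 0 := by
        by_contra! hcon
        rw [sum_eq_zero hcon] at hc
        omega
      refine ⟨_, (mem_hFoldSumset h A _).2 ⟨Function.update c a (c a - 1), ?_, rfl⟩, a, ha, ?_⟩
      · rw [sum_update_of_mem ha, sdiff_singleton_eq_erase]
        have := add_sum_erase A c ha
        omega
      · rw [← add_sum_erase A _ ha, ← add_sum_erase A (fun x => (c x : ℤ) * x) ha,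
          sum_congr rfl (g := fun x => (c x : ℤ) * x)]
        · rw [Function.update_self, Nat.cast_pred (Nat.pos_of_ne_zero hca)]
          ring
        · intro x hx
          rw [Function.update_of_ne (ne_of_mem_erase hx)]
    · rintro ⟨m, hm, a, ha, rfl⟩
      obtain ⟨c, hc, rfl⟩ := (mem_hFoldSumset h A _).1 hm
      refine ⟨fun x => c x + if x = a then 1 else 0, ?_, ?_⟩
      · simp [sum_add_distrib, hc, ha]
      · simp [add_mul, sum_add_distrib, ha]

/-- The largest element `q` of `(j+1)A` in each residue class is new: if it were in `jA`, then `q +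
l` would be in `(j+1)A`. -/
theorem card_nsmul_add_card_nsmul_image_le {l : ℕ} (hl : 0 < l) {A : Finset ℤ} (h0 : 0 ∈ A)
    (hlA : (l : ℤ) ∈ A) (j : ℕ) :
    (j • A).card + ((j + 1) • A.image (Int.castAddHom (ZMod l))).card ≤ ((j + 1) • A).card := by
  classical
  have hsub : j • A ⊆ (j + 1) • A := by
    rw [succ_nsmul]; exact subset_add_left _ h0
  have himg : (j + 1) • A.image (Int.castAddHom (ZMod l)) ⊆
      ((j + 1) • A \ j • A).image (Int.castAddHom (ZMod l)) := by
    rw [← image_nsmul]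
    intro r hr
    obtain ⟨x, hx, rfl⟩ := mem_image.1 hr
    obtain ⟨q, hq, hqmax⟩ := exists_max_image
      (((j + 1) • A).filter fun y => Int.castAddHom (ZMod l) y = Int.castAddHom (ZMod l) x) id
      ⟨x, mem_filter.2 ⟨hx, rfl⟩⟩
    rw [mem_filter] at hq
    refine mem_image.2 ⟨q, mem_sdiff.2 ⟨hq.1, fun hqj => ?_⟩, hq.2⟩
    have := hqmax (q + l) (mem_filter.2 ⟨?_, by rw [← hq.2]; simp⟩)
    · simp only [id] at this
      omega
    · rw [succ_nsmul]; exact add_mem_add hqj hlA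
  have h1 := (card_le_card himg).trans card_image_le
  have h2 := card_sdiff_add_card_eq_card hsub
  omega

theorem card_nsmul_add_mul_le {l : ℕ} (hl : 0 < l) {A : Finset ℤ} (h0 : 0 ∈ A)
    (hlA : (l : ℤ) ∈ A) {m c : ℕ}
    (hc : ∀ j, m < j → c ≤ (j • A.image (Int.castAddHom (ZMod l))).card) (t : ℕ) :
    (m • A).card + t * c ≤ ((m + t) • A).card := by
  induction t with
  | zero => simp
  | succ t ih =>
    have h1 := card_nsmul_add_card_nsmul_image_le hl h0 hlA (m + t)
    have h2 := hc (m + t + 1) (by omega)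
    rw [← add_assoc, add_mul]
    omega

theorem eq_top_of_image_castAddHom_subset {l : ℕ} {A : Finset ℤ}
    (hA : ∀ d : ℤ, (∀ a ∈ A, d ∣ a) → IsUnit d) (H : AddSubgroup (ZMod l))
    (hH : ((A.image (Int.castAddHom (ZMod l)) : Finset (ZMod l)) : Set (ZMod l)) ⊆ H) : H = ⊤ := by
  obtain ⟨d, hd⟩ := Int.subgroup_cyclic (H.comap (Int.castAddHom (ZMod l)))
  have hdvd : ∀ x : ℤ, x ∈ H.comap (Int.castAddHom (ZMod l)) ↔ d ∣ x := by
    intro x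
    rw [hd, ← AddSubgroup.zmultiples_eq_closure, Int.mem_zmultiples_iff]
  have hu : IsUnit d := hA d fun a ha => (hdvd a).1 (hH (by simpa using ⟨a, ha, rfl⟩))
  rw [eq_top_iff]
  intro z _
  obtain ⟨x, rfl⟩ := ZMod.intCast_surjective z
  exact (hdvd x).2 hu.dvd

theorem card_image_castAddHom {l : ℕ} {A : Finset ℤ} (hlA : (l : ℤ) ∈ A)
    (hA : ∀ a ∈ A, 0 ≤ a ∧ a ≤ l) :
    A.card ≤ (A.image (Int.castAddHom (ZMod l))).card + 1 := by
  classical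
  have h1 : ((A.erase l).image (Int.castAddHom (ZMod l))).card = (A.erase l).card := by
    apply card_image_of_injOn
    intro x hx y hy hxy
    have hx' := mem_erase.1 hx
    have hy' := mem_erase.1 hy
    have hx1 := hA x hx'.2
    have hy1 := hA y hy'.2
    have h2 : (x : ZMod l) = y := by simpa using hxy
    rw [ZMod.intCast_eq_intCast_iff'] at h2
    rwa [Int.emod_eq_of_lt hx1.1 (lt_of_le_of_ne hx1.2 hx'.1),
      Int.emod_eq_of_lt hy1.1 (lt_of_le_of_ne hy1.2 hy'.1)] at h2
  have h2 := card_le_card (image_subset_image (f := Int.castAddHom (ZMod l)) (erase_subset (l : ℤ) A))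
  rw [h1] at h2
  have := card_erase_add_one hlA
  omega

/-- Exhaustive check for `k = 5`, `l = 8`, where Olson's bound yields only `5 + 6 = 11`. -/
theorem twelve_le_card_add_self : ∀ S ∈ (Icc (0 : ℤ) 8).powersetCard 5, 0 ∈ S → 8 ∈ S →
    (∃ a ∈ S, ¬ (2 : ℤ) ∣ a) → 12 ≤ (S + S).card := by
  decide +kernel

theorem nsmul_subset_nsmul_of_zero_mem {G : Type*} [AddCommGroup G] [DecidableEq G] {B : Finset G}
    (h0 : 0 ∈ B) {i j : ℕ} (hij : i ≤ j) : i • B ⊆ j • B := by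
  obtain ⟨t, rfl⟩ := Nat.exists_eq_add_of_le hij
  rw [add_nsmul]
  exact subset_add_left _ (by simpa using nsmul_mem_nsmul (n := t) h0)

/-- In normal form, a set of large diameter has a large sumset. -/
theorem le_card_nsmul_of_normal {l h : ℕ} {A : Finset ℤ} (h0 : 0 ∈ A)
    (hlA : (l : ℤ) ∈ A) (hA : ∀ a ∈ A, 0 ≤ a ∧ a ≤ l)
    (hgcd : ∀ d : ℤ, (∀ a ∈ A, d ∣ a) → IsUnit d) (hk : 5 ≤ A.card) (hl : A.card + 3 ≤ l)
    (hh : 4 ≤ h) :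
    h * A.card + 3 * h ≤ (h • A).card + 3 + (if A.card = 5 then 1 else 0) := by
  classical
  have hl0 : 0 < l := by omega
  have : NeZero l := ⟨hl0.ne'⟩
  have hB := card_image_castAddHom hlA hA
  have hgen := eq_top_of_image_castAddHom_subset (l := l) hgcd
  have hstep := card_nsmul_add_card_nsmul_image_le hl0 h0 hlA
  have hiter := fun m c => card_nsmul_add_mul_le (m := m) (c := c) hl0 h0 hlA
  obtain ⟨B, hBdef⟩ : ∃ B, B = A.image (Int.castAddHom (ZMod l)) := ⟨_, rfl⟩
  rw [← hBdef] at hB hgen hstep hiter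
  have hB0 : 0 ∈ B := hBdef ▸ mem_image.2 ⟨0, h0, map_zero _⟩
  have hmono : ∀ {i j : ℕ}, i ≤ j → (i • B).card ≤ (j • B).card := fun hij =>
    card_le_card (nsmul_subset_nsmul_of_zero_mem hB0 hij)
  have hgrow : ∀ j : ℕ, ((j + 1) • B).card = l ∨
      2 * (j • B).card + B.card ≤ 2 * ((j + 1) • B).card := by
    intro j
    rw [succ_nsmul]
    by_cases hu : j • B + B = univ
    · left; rw [hu, card_univ, ZMod.card]
    · right
      exact olson_card_add hB0 hgen ⟨0, by simpa using nsmul_mem_nsmul (n := j) hB0⟩ hu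
  have hle : ∀ j : ℕ, (j • B).card ≤ l := fun j =>
    (card_le_univ (j • B)).trans_eq (ZMod.card l)
  have hg1 := hgrow 1
  have hg2 := hgrow 2
  have hg3 := hgrow 3
  have hs1 := hstep 1
  have hs2 := hstep 2
  have hm1 := hmono (show 1 ≤ 2 by norm_num)
  have hm2 := hmono (show 2 ≤ 3 by norm_num)
  have hm3 := hmono (show 3 ≤ 4 by norm_num)
  have hl2 := hle 2
  have hl3 := hle 3
  norm_num at hg1 hg2 hg3 hs1 hs2 hm1
  obtain ⟨k, hkdef⟩ : ∃ k, A.card = k := ⟨_, rfl⟩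
  rw [hkdef] at hk hl hB hs1 ⊢
  rcases eq_or_lt_of_le hk with hk5 | hk6
  · subst hk5
    simp only [if_true]
    rcases eq_or_lt_of_le hl with hl8 | hl9
    · subst hl8
      obtain ⟨t, rfl⟩ := Nat.exists_eq_add_of_le (show 2 ≤ h by omega)
      have h2A : 12 ≤ (2 • A).card := by
        rw [two_nsmul]
        refine twelve_le_card_add_self A (mem_powersetCard.2 ⟨fun a ha => ?_, hkdef⟩) h0 hlA ?_
        · exact mem_Icc.2 (by simpa using hA a ha)
        · by_contra! hcon
          have := hgcd 2 hcon
          norm_num [Int.isUnit_iff] at this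
      have := hiter 2 8 (fun j hj => by have := hmono (show 3 ≤ j by omega); omega) t
      omega
    -- Here `|3A| ≥ 5 + 6 + 8 = 19`, one short of the target; the gain of 9 at the fourth step,
    -- hence `h ≥ 4`, makes it up.
    · obtain ⟨t, rfl⟩ := Nat.exists_eq_add_of_le (show 3 ≤ h by omega)
      have := hiter 3 9 (fun j hj => by have := hmono (show 4 ≤ j by omega); omega) t
      omega
  · rw [if_neg (by omega)]
    rcases eq_or_lt_of_le hl with hl4 | hl5
    -- Pigeonhole: `2(k - 1) > k + 3` since `k ≥ 6`.
    · have h2B : (2 • B).card = l := by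
        rw [two_nsmul, add_eq_univ_of_card_lt (by rw [ZMod.card]; omega), card_univ, ZMod.card]
      obtain ⟨t, rfl⟩ := Nat.exists_eq_add_of_le (show 1 ≤ h by omega)
      have := hiter 1 (k + 3) (fun j hj => by have := hmono (show 2 ≤ j by omega); omega) t
      rw [one_nsmul, hkdef] at this
      linarith
    · obtain ⟨t, rfl⟩ := Nat.exists_eq_add_of_le (show 3 ≤ h by omega)
      have := hiter 3 (k + 3) (fun j hj => by have := hmono (show 3 ≤ j by omega); omega) t
      have h3 : 3 * k + 6 ≤ (3 • A).card := by omega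
      linarith

theorem card_nsmul_le_of_subset_Icc {A : Finset ℤ} {l : ℕ} (hA : ∀ a ∈ A, 0 ≤ a ∧ a ≤ l) (h : ℕ) :
    (h • A).card ≤ h * l + 1 := by
  have hsub : h • A ⊆ Icc 0 ((h * l : ℕ) : ℤ) := by
    induction h with
    | zero => intro x; simp
    | succ h ih =>
      rw [succ_nsmul]
      intro x hx
      obtain ⟨y, hy, a, ha, rfl⟩ := mem_add.1 hx
      have h1 := mem_Icc.1 (ih hy)
      have h2 := hA a ha
      rw [mem_Icc]
      push_cast at h1 ⊢
      constructor <;> linarith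
  have := card_le_card hsub
  rw [Int.card_Icc] at this
  omega

/-! ### Affine normalisation and conclusion -/

theorem card_nsmul_image_affine (A : Finset ℤ) (m : ℤ) {g : ℤ} (hg : g ≠ 0) (h : ℕ) :
    (h • A.image fun x => m + g * x).card = (h • A).card := by
  have h1 : h • (A.image fun x => m + g * x) = (h • A).image fun x => h * m + g * x := by
    induction h with
    | zero => ext; simp
    | succ h ih =>
      rw [succ_nsmul, ih, succ_nsmul]
      ext n
      simp only [mem_add, mem_image]
      constructor
      · rintro ⟨_, ⟨x, hx, rfl⟩, _, ⟨y, hy, rfl⟩, rfl⟩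
        exact ⟨x + y, ⟨x, hx, y, hy, rfl⟩, by push_cast; ring⟩
      · rintro ⟨_, ⟨x, hx, y, hy, rfl⟩, rfl⟩
        exact ⟨_, ⟨x, hx, rfl⟩, _, ⟨y, hy, rfl⟩, by push_cast; ring⟩
  rw [h1, card_image_of_injective]
  intro x y hxy
  simpa [hg] using hxy

theorem exists_normal_form {A : Finset ℤ} (hA : 2 ≤ A.card) :
    ∃ (A' : Finset ℤ) (m g : ℤ) (l : ℕ), g ≠ 0 ∧ A = A'.image (fun x => m + g * x) ∧ 0 ∈ A' ∧
      (l : ℤ) ∈ A' ∧ (∀ a ∈ A', 0 ≤ a ∧ a ≤ l) ∧ ∀ d : ℤ, (∀ a ∈ A', d ∣ a) → IsUnit d := by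
  classical
  have hne : A.Nonempty := card_pos.1 (by omega)
  obtain ⟨f, hf, hf1⟩ := extract_gcd (fun a => a - A.min' hne) hne
  obtain ⟨g, hgdef⟩ : ∃ g, g = A.gcd fun a => a - A.min' hne := ⟨_, rfl⟩
  simp only [← hgdef] at hf
  have hg0 : 0 ≤ g := by
    rw [hgdef, ← Finset.normalize_gcd]
    exact Int.nonneg_of_normalize_eq_self (normalize_idem _)
  have hg : g ≠ 0 := by
    rintro rfl
    have : A ⊆ {A.min' hne} := fun a ha => by
      have := hf a ha
      rw [mem_singleton]
      linarith
    have := card_le_card this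
    rw [card_singleton] at this
    omega
  have hgpos : 0 < g := lt_of_le_of_ne hg0 hg.symm
  have hmin := A.min'_mem hne
  have hmax := A.max'_mem hne
  have hf0 : f (A.min' hne) = 0 := by
    have := hf _ hmin
    simpa [hg] using this
  have hpos : ∀ a ∈ A, 0 ≤ f a := fun a ha => by
    have h1 := A.min'_le a ha
    have h2 := hf a ha
    by_contra! h3
    nlinarith
  have hlt : ∀ a ∈ A, f a ≤ f (A.max' hne) := fun a ha => by
    have h1 := A.le_max' a ha
    have h2 := hf a ha
    have h3 := hf _ hmax
    by_contra! h4
    nlinarith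
  refine ⟨A.image f, A.min' hne, g, (f (A.max' hne)).toNat, hg, ?_, ?_, ?_, ?_, ?_⟩
  · rw [image_image]
    conv_lhs => rw [← image_id (s := A)]
    refine image_congr fun a ha => ?_
    have := hf a ha
    simp only [Function.comp, id]
    linarith
  · exact mem_image.2 ⟨_, hmin, hf0⟩
  · rw [Int.toNat_of_nonneg (hpos _ hmax)]
    exact mem_image_of_mem _ hmax
  · intro a ha
    obtain ⟨b, hb, rfl⟩ := mem_image.1 ha
    rw [Int.toNat_of_nonneg (hpos _ hmax)]
    exact ⟨hpos b hb, hlt b hb⟩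
  · intro d hd
    apply isUnit_of_dvd_one
    rw [← hf1]
    exact dvd_gcd fun b hb => hd _ (mem_image_of_mem _ hb)

theorem mainTheorem6 (h k i : ℕ) (hi : 2 ≤ i)
    (hik : (5 ≤ k ∧ i + 5 ≤ h) ∨ (6 ≤ k ∧ i + 4 ≤ h)) :
    ¬ ∃ A : Finset ℤ, A.card = k ∧
      h * k + 2 * h + 2 ≤ (hFoldSumset h A).card ∧
      (hFoldSumset h A).card = h * k + 2 * h + i ∧
      (hFoldSumset h A).card ≤ h * k + 3 * h - 4 := by
  rintro ⟨A, hAk, -, hcard, -⟩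
  obtain ⟨A', m, g, l, hg, rfl, h0, hl, hA', hgcd⟩ := exists_normal_form (A := A) (by omega)
  rw [hFoldSumset_eq_nsmul, card_nsmul_image_affine A' m hg] at hcard
  rw [card_image_of_injective _ (fun x y hxy => by simpa [hg] using hxy)] at hAk
  by_cases hkl : k + 3 ≤ l
  · have := le_card_nsmul_of_normal (h := h) h0 hl hA' hgcd (by omega) (by omega) (by omega)
    rw [hAk] at this
    split_ifs at this <;> omega
  · have h1 := card_nsmul_le_of_subset_Icc hA' h
    have h2 : h * l ≤ h * (k + 2) := Nat.mul_le_mul_left h (by omega)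
    rw [mul_add] at h2
    omega
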